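/- Let $\mathbb F$ be a field of characteristic $2$ over which every polynomial of degree $2$ or $3$ has a root. An algebra over $\mathbb F$ is a vector space $\mathbb A$ with a bilinear multiplication (no further identity is assumed); it is nontrivial if not all products are zero, and $\mathbb A^{op}$ denotes the same vector space with the product $\mathbf u*\mathbf v=\mathbf v\cdot\mathbf u$. A matrix $$\begin{pmatrix}\alpha_1&\alpha_2&\alpha_3&\alpha_4\\ \beta_1&\beta_2&\beta_3&\beta_4\end{pmatrix}$$ denotes the algebra with basis $e_1,e_2$ and products $e_1e_1=\alpha_1e_1+\beta_1e_2$, $e_1e_2=\alpha_2e_1+\beta_2e_2$, $e_2e_1=\alpha_3e_1+\beta_3e_2$, $e_2e_2=\alpha_4e_1+\beta_4e_2$. Put $$A_{1,2}(\alpha_1,\alpha_2,\alpha_4,\beta_1)=\begin{pmatrix}\alpha_1&\alpha_2&1+\alpha_2&\alpha_4\\ \beta_1&\alpha_1&1+\alpha_1&\alpha_2\end{pmatrix},\quad A_{2,2}(\alpha_1,\beta_1,\beta_2)=\begin{pmatrix}\alpha_1&0&0&1\\ \beta_1&\beta_2&1+\alpha_1&0\end{pmatrix},$$ $$A_{3,2}(\alpha_1,\beta_2)=\begin{pmatrix}\alpha_1&1&1&0\\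 0&\beta_2&1+\alpha_1&1\end{pmatrix},\quad A_{4,2}(\alpha_1,\beta_2)=\begin{pmatrix}\alpha_1&0&0&0\\ 0&\beta_2&1+\alpha_1&0\end{pmatrix},\quad A_{5,2}(\alpha_1)=\begin{pmatrix}\alpha_1&0&0&0\\ 1&1&1+\alpha_1&0\end{pmatrix},$$ $$A_{10,2}=\begin{pmatrix}0&1&1&0\\ 0&0&0&1\end{pmatrix},\quad A_{11,2}=\begin{pmatrix}1&1&1&0\\ 0&1&1&1\end{pmatrix},\quad A_{12,2}=\begin{pmatrix}0&0&0&0\\ 1&0&0&0\end{pmatrix}.$$ Then, up to isomorphism, the nontrivial two-dimensional algebras $\mathbb A$ over $\mathbb F$ with $\mathbb A^{op}\cong\mathbb A$ are exactly the following, where the parameters take arbitrary values in $\mathbb F$: $$A_{1,2}(\alpha_1,\alpha_1,\alpha_2,\alpha_2),\ A_{2,2}(\alpha_1,\beta_1,1+\alpha_1),\ A_{3,2}(\alpha_1,1+\alpha_1),\ A_{4,2}(\alpha_1,1+\alpha_1),\ A_{5,2}(0),\ A_{10,2},\ A_{11,2},\ A_{12,2}.$$ That is, each of these algebras is nontrivial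 and isomorphic to its opposite, every nontrivial two-dimensional algebra isomorphic to its opposite is isomorphic to one of them, and no two of them (different families, or different parameter values in one family) are isomorphic. -/

import Mathlib

/-- A (not necessarily associative, not necessarily unital) `F`-algebra on a vector space `V`:
a bilinear multiplication `V × V → V`. -/
abbrev AlgStr (F V : Type*) [Field F] [AddCommGroup V] [Module F V] : Type _ :=
  V →ₗ[F] V →ₗ[F] V

/-- The opposite algebra: `u * v = v · u`. -/
def AlgStr.op {F V : Type*} [Field F] [AddCommGroup V] [Module F V]
    (m : AlgStr F V) : AlgStr F V :=
  LinearMap.flip m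

/-- Isomorphism of algebras: a bijective linear map that preserves the products. -/
def AlgStr.Iso {F V W : Type*} [Field F] [AddCommGroup V] [Module F V]
    [AddCommGroup W] [Module F W] (m : AlgStr F V) (n : AlgStr F W) : Prop :=
  ∃ f : V ≃ₗ[F] W, ∀ x y : V, f (m x y) = n (f x) (f y)

/-- The algebra on `F²` whose matrix of structure constants with respect to the standard basis
`(e₁, e₂)` is `M`: the columns of `M` are the coordinates of `e₁e₁`, `e₁e₂`, `e₂e₁`, `e₂e₂`. -/
def mscAlgebra {F : Type*} [Field F] (M : Matrix (Fin 2) (Fin 4) F) : AlgStr F (Fin 2 → F) :=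
  LinearMap.mk₂ F
    (fun x y => Matrix.mulVec M ![x 0 * y 0, x 0 * y 1, x 1 * y 0, x 1 * y 1])
    (by intro x x' y; ext i; simp [Matrix.mulVec, dotProduct, Fin.sum_univ_four]; ring)
    (by intro c x y; ext i; simp [Matrix.mulVec, dotProduct, Fin.sum_univ_four]; ring)
    (by intro x y y'; ext i; simp [Matrix.mulVec, dotProduct, Fin.sum_univ_four]; ring)
    (by intro c x y; ext i; simp [Matrix.mulVec, dotProduct, Fin.sum_univ_four]; ring)

/-- The columns of `M` are the four products of basis vectors, in the order 11, 12, 21, 22. -/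
theorem mscAlgebra_basis {F : Type*} [Field F] (M : Matrix (Fin 2) (Fin 4) F) (i : Fin 2) :
    mscAlgebra M ![1, 0] ![1, 0] i = M i 0 ∧ mscAlgebra M ![1, 0] ![0, 1] i = M i 1 ∧
    mscAlgebra M ![0, 1] ![1, 0] i = M i 2 ∧ mscAlgebra M ![0, 1] ![0, 1] i = M i 3 := by
  simp [mscAlgebra, Matrix.mulVec, dotProduct, Fin.sum_univ_four]

/-! The canonical matrices of structure constants in characteristic 2 that occur in the list. -/

namespace CharTwo

variable {F : Type*} [Field F]

/-- `A_{1,2}(α₁, α₂, α₄, β₁)` -/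
def A1 (α₁ α₂ α₄ β₁ : F) : Matrix (Fin 2) (Fin 4) F :=
  !![α₁, α₂, 1 + α₂, α₄;
     β₁, α₁, 1 + α₁, α₂]

/-- `A_{2,2}(α₁, β₁, β₂)` -/
def A2 (α₁ β₁ β₂ : F) : Matrix (Fin 2) (Fin 4) F :=
  !![α₁, 0, 0, 1;
     β₁, β₂, 1 + α₁, 0]

/-- `A_{3,2}(α₁, β₂)` -/
def A3 (α₁ β₂ : F) : Matrix (Fin 2) (Fin 4) F :=
  !![α₁, 1, 1, 0;
     0, β₂, 1 + α₁, 1]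

/-- `A_{4,2}(α₁, β₂)` -/
def A4 (α₁ β₂ : F) : Matrix (Fin 2) (Fin 4) F :=
  !![α₁, 0, 0, 0;
     0, β₂, 1 + α₁, 0]

/-- `A_{5,2}(α₁)` -/
def A5 (α₁ : F) : Matrix (Fin 2) (Fin 4) F :=
  !![α₁, 0, 0, 0;
     1, 1, 1 + α₁, 0]

/-- `A_{10,2}` -/
def A10 : Matrix (Fin 2) (Fin 4) F :=
  !![0, 1, 1, 0;
     0, 0, 0, 1]

/-- `A_{11,2}` -/
def A11 : Matrix (Fin 2) (Fin 4) F :=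
  !![1, 1, 1, 0;
     0, 1, 1, 1]

/-- `A_{12,2}` -/
def A12 : Matrix (Fin 2) (Fin 4) F :=
  !![0, 0, 0, 0;
     1, 0, 0, 0]

end CharTwo

/-- Labels (family and parameters) of the entries of the list of self-opposite algebras. -/
inductive SelfOpLabel (F : Type*) : Type _
  | a1 (α₁ α₂ : F)
  | a2 (α₁ β₁ : F)
  | a3 (α₁ : F)
  | a4 (α₁ : F)
  | a5
  | a10
  | a11
  | a12

/-- The matrix of structure constants of the entry with a given label. -/
def SelfOpLabel.msc {F : Type*} [Field F] : SelfOpLabel F → Matrix (Fin 2) (Fin 4) F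
  | a1 α₁ α₂ => CharTwo.A1 α₁ α₁ α₂ α₂
  | a2 α₁ β₁ => CharTwo.A2 α₁ β₁ (1 + α₁)
  | a3 α₁ => CharTwo.A3 α₁ (1 + α₁)
  | a4 α₁ => CharTwo.A4 α₁ (1 + α₁)
  | a5 => CharTwo.A5 0
  | a10 => CharTwo.A10
  | a11 => CharTwo.A11
  | a12 => CharTwo.A12

/-! The proof rests on two linear forms, λ(x) = tr(L_x) and ρ(x) = tr(R_x), the traces of left and
right multiplication. Isomorphisms preserve them and passing to the opposite swaps them.

If λ and ρ are independent, their dual basis is canonical, so an isomorphism onto the opposite must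
exchange its two vectors; this forces the family `a1`. If they are dependent, such an isomorphism
turns ρ = cλ into c² = 1, hence c = 1 in characteristic 2 (or both forms vanish). In dimension two λ
= ρ already means commutativity.

For commutative algebras in characteristic 2 cross terms drop out of squares, so x ↦ x² is additive.
If λ ≠ 0, the basis is adapted to ker λ and quadratic equations lead to `a2`–`a5`. If λ = 0, a cubic
equation gives a line stable under squaring, and `a10`–`a12` remain.

The same forms separate the entries: they are independent for `a1`, equal to the first coordinate
for `a2`–`a5`, and zero for `a10`–`a12`. -/

/-- The linear map with matrix `!![p, q; r, s]` is an isomorphism from the algebra with structure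
constants `M` to the one with structure constants `N`. -/
structure IsMscIso {F : Type*} [Field F] (M N : Matrix (Fin 2) (Fin 4) F) (p q r s : F) : Prop where
  det : p * s - q * r ≠ 0
  h00 : p * M 0 0 + q * M 1 0 = N 0 0 * p * p + N 0 1 * p * r + N 0 2 * r * p + N 0 3 * r * r
  h10 : r * M 0 0 + s * M 1 0 = N 1 0 * p * p + N 1 1 * p * r + N 1 2 * r * p + N 1 3 * r * r
  h01 : p * M 0 1 + q * M 1 1 = N 0 0 * p * q + N 0 1 * p * s + N 0 2 * r * q + N 0 3 * r * s
  h11 : r * M 0 1 + s * M 1 1 = N 1 0 * p * q + N 1 1 * p * s + N 1 2 * r * q + N 1 3 * r * s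
  h02 : p * M 0 2 + q * M 1 2 = N 0 0 * q * p + N 0 1 * q * r + N 0 2 * s * p + N 0 3 * s * r
  h12 : r * M 0 2 + s * M 1 2 = N 1 0 * q * p + N 1 1 * q * r + N 1 2 * s * p + N 1 3 * s * r
  h03 : p * M 0 3 + q * M 1 3 = N 0 0 * q * q + N 0 1 * q * s + N 0 2 * s * q + N 0 3 * s * s
  h13 : r * M 0 3 + s * M 1 3 = N 1 0 * q * q + N 1 1 * q * s + N 1 2 * s * q + N 1 3 * s * s

/-! ### Isomorphisms in coordinates. -/

section

variable {F : Type*} [Field F]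

theorem mscAlgebra_apply_zero (M : Matrix (Fin 2) (Fin 4) F) (x y : Fin 2 → F) :
    mscAlgebra M x y 0 =
      M 0 0 * (x 0 * y 0) + M 0 1 * (x 0 * y 1) + M 0 2 * (x 1 * y 0) + M 0 3 * (x 1 * y 1) := by
  simp [mscAlgebra, Matrix.mulVec, dotProduct, Fin.sum_univ_four]

theorem mscAlgebra_apply_one (M : Matrix (Fin 2) (Fin 4) F) (x y : Fin 2 → F) :
    mscAlgebra M x y 1 =
      M 1 0 * (x 0 * y 0) + M 1 1 * (x 0 * y 1) + M 1 2 * (x 1 * y 0) + M 1 3 * (x 1 * y 1) := by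
  simp [mscAlgebra, Matrix.mulVec, dotProduct, Fin.sum_univ_four]

theorem eq_smul_basis (x : Fin 2 → F) : x = x 0 • ![1, 0] + x 1 • ![0, 1] := by
  ext i; fin_cases i <;> simp

/-- The linear automorphism of `F²` with matrix `!![p, q; r, s]`. -/
noncomputable def planeEquiv (p q r s : F) (h : p * s - q * r ≠ 0) :
    (Fin 2 → F) ≃ₗ[F] (Fin 2 → F) :=
  Matrix.toLin'OfInv (M := (p * s - q * r)⁻¹ • !![s, -q; -r, p])
    (M' := !![p, q; r, s])
    (by
      rw [Matrix.smul_mul, inv_smul_eq_iff₀ h]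
      ext i j; fin_cases i <;> fin_cases j <;> simp [Matrix.mul_apply, Fin.sum_univ_two] <;> ring)
    (by
      rw [Matrix.mul_smul, inv_smul_eq_iff₀ h]
      ext i j; fin_cases i <;> fin_cases j <;> simp [Matrix.mul_apply, Fin.sum_univ_two] <;> ring)

theorem planeEquiv_apply (p q r s : F) (h : p * s - q * r ≠ 0) (x : Fin 2 → F) :
    planeEquiv p q r s h x = ![p * x 0 + q * x 1, r * x 0 + s * x 1] := by
  ext i
  fin_cases i <;>
    simp [planeEquiv, Matrix.toLin'OfInv, Matrix.mulVec, dotProduct, Fin.sum_univ_two]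

theorem eq_planeEquiv (f : (Fin 2 → F) ≃ₗ[F] (Fin 2 → F)) :
    ∃ p q r s h, f = planeEquiv p q r s h := by
  have hf : ∀ x, f x = x 0 • f ![1, 0] + x 1 • f ![0, 1] := fun x => by
    conv_lhs => rw [eq_smul_basis x]
    simp only [map_add, map_smul]
  refine ⟨f ![1, 0] 0, f ![0, 1] 0, f ![1, 0] 1, f ![0, 1] 1, fun h => ?_, ?_⟩
  -- With vanishing determinant, the adjugate supplies kernel vectors of `f`; injectivity then makes
  -- `f ![1, 0]` zero.
  · set u := f ![1, 0] with hu
    set v := f ![0, 1] with hv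
    have h1 : f ![v 1, -u 1] = 0 := by
      rw [hf]; ext i; fin_cases i <;> simp <;> grind
    have h2 : f ![v 0, -u 0] = 0 := by
      rw [hf]; ext i; fin_cases i <;> simp <;> grind
    rw [LinearEquiv.map_eq_zero_iff] at h1 h2
    have e1 := congrFun h1 1
    have e2 := congrFun h2 1
    simp only [Matrix.cons_val_one, Pi.zero_apply, neg_eq_zero,
      Matrix.cons_val_fin_one] at e1 e2
    have : f ![1, 0] = 0 := by
      rw [← hu]; ext i; fin_cases i
      · exact e2
      · exact e1
    rw [LinearEquiv.map_eq_zero_iff] at this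
    simpa using congrFun this 0
  · ext1 x
    rw [planeEquiv_apply, hf]
    ext i; fin_cases i <;> simp <;> ring

theorem mscAlgebra_iso_iff {M N : Matrix (Fin 2) (Fin 4) F} :
    (mscAlgebra M).Iso (mscAlgebra N) ↔ ∃ p q r s, IsMscIso M N p q r s := by
  constructor
  · rintro ⟨f, hf⟩
    obtain ⟨p, q, r, s, h, rfl⟩ := eq_planeEquiv f
    have key : ∀ x y i, _ := fun x y i => congrFun (hf x y) i
    simp only [planeEquiv_apply] at key
    have k00 := key ![1, 0] ![1, 0]
    have k01 := key ![1, 0] ![0, 1]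
    have k10 := key ![0, 1] ![1, 0]
    have k11 := key ![0, 1] ![0, 1]
    simp only [Fin.forall_fin_two, mscAlgebra_apply_zero, mscAlgebra_apply_one, Matrix.cons_val_zero,
      Matrix.cons_val_one, Matrix.cons_val_fin_one] at k00 k01 k10 k11
    refine ⟨p, q, r, s, h, ?_, ?_, ?_, ?_, ?_, ?_, ?_, ?_⟩
    · linear_combination k00.1
    · linear_combination k00.2
    · linear_combination k01.1
    · linear_combination k01.2
    · linear_combination k10.1
    · linear_combination k10.2
    · linear_combination k11.1
    · linear_combination k11.2
  · rintro ⟨p, q, r, s, h, h00, h10, h01, h11, h02, h12, h03, h13⟩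
    refine ⟨planeEquiv p q r s h, fun x y => ?_⟩
    simp only [planeEquiv_apply]
    ext i
    fin_cases i
    · simp only [Fin.zero_eta, mscAlgebra_apply_zero, mscAlgebra_apply_one, Matrix.cons_val_zero,
        Matrix.cons_val_one, Matrix.cons_val_fin_one]
      linear_combination x 0 * y 0 * h00 + x 0 * y 1 * h01 + x 1 * y 0 * h02 + x 1 * y 1 * h03
    · simp only [Fin.mk_one, mscAlgebra_apply_zero, mscAlgebra_apply_one, Matrix.cons_val_zero,
        Matrix.cons_val_one, Matrix.cons_val_fin_one]
      linear_combination x 0 * y 0 * h10 + x 0 * y 1 * h11 + x 1 * y 0 * h12 + x 1 * y 1 * h13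

section

variable {V W U : Type*} [AddCommGroup V] [Module F V] [AddCommGroup W] [Module F W]
  [AddCommGroup U] [Module F U]

theorem AlgStr.Iso.symm {m : AlgStr F V} {n : AlgStr F W} (h : m.Iso n) : n.Iso m := by
  obtain ⟨f, hf⟩ := h
  exact ⟨f.symm, fun x y => f.injective (by simp [hf])⟩

theorem AlgStr.Iso.trans {m : AlgStr F V} {n : AlgStr F W} {k : AlgStr F U} (h : m.Iso n)
    (h' : n.Iso k) : m.Iso k := by
  obtain ⟨f, hf⟩ := h
  obtain ⟨g, hg⟩ := h'
  exact ⟨f.trans g, fun x y => by simp [hf, hg]⟩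

theorem AlgStr.Iso.op {m : AlgStr F V} {n : AlgStr F W} (h : m.Iso n) : m.op.Iso n.op := by
  obtain ⟨f, hf⟩ := h
  exact ⟨f, fun x y => hf y x⟩

/-- Transport of the multiplication along a linear equivalence. -/
theorem AlgStr.exists_iso_of_equiv (m : AlgStr F V) (e : V ≃ₗ[F] W) :
    ∃ n : AlgStr F W, ∀ x y, e (m x y) = n (e x) (e y) :=
  ⟨(m.compl₁₂ e.symm.toLinearMap e.symm.toLinearMap).compr₂ e.toLinearMap, fun x y => by simp⟩

end

theorem exists_eq_mscAlgebra (m : AlgStr F (Fin 2 → F)) : ∃ M, m = mscAlgebra M := by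
  refine ⟨Matrix.of fun i => ![m ![1, 0] ![1, 0] i, m ![1, 0] ![0, 1] i, m ![0, 1] ![1, 0] i,
    m ![0, 1] ![0, 1] i], LinearMap.ext fun x => LinearMap.ext fun y => ?_⟩
  conv_lhs => rw [eq_smul_basis x, eq_smul_basis y]
  simp only [map_add, map_smul, LinearMap.add_apply, LinearMap.smul_apply]
  ext i
  fin_cases i
  · simp [mscAlgebra_apply_zero]; ring
  · simp [mscAlgebra_apply_one]; ring

theorem exists_iso_mscAlgebra {V : Type*} [AddCommGroup V] [Module F V] (m : AlgStr F V)
    (h : Module.finrank F V = 2) : ∃ M, m.Iso (mscAlgebra M) := by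
  have : Module.Finite F V := Module.finite_of_finrank_pos (by omega)
  let e := (Module.finBasisOfFinrankEq F V h).equivFun
  obtain ⟨n, hn⟩ := m.exists_iso_of_equiv e
  obtain ⟨M, rfl⟩ := exists_eq_mscAlgebra n
  exact ⟨M, e, hn⟩

/-- Every invertible matrix is a change of basis for the given structure constants. -/
theorem exists_isMscIso (M : Matrix (Fin 2) (Fin 4) F) {p q r s : F} (h : p * s - q * r ≠ 0) :
    ∃ N, IsMscIso N M p q r s := by
  set D := p * s - q * r with hD
  refine ⟨!![D⁻¹ * (s * (M 0 0 * p * p + M 0 1 * p * r + M 0 2 * r * p + M 0 3 * r * r)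
      - q * (M 1 0 * p * p + M 1 1 * p * r + M 1 2 * r * p + M 1 3 * r * r)),
      D⁻¹ * (s * (M 0 0 * p * q + M 0 1 * p * s + M 0 2 * r * q + M 0 3 * r * s)
      - q * (M 1 0 * p * q + M 1 1 * p * s + M 1 2 * r * q + M 1 3 * r * s)),
      D⁻¹ * (s * (M 0 0 * q * p + M 0 1 * q * r + M 0 2 * s * p + M 0 3 * s * r)
      - q * (M 1 0 * q * p + M 1 1 * q * r + M 1 2 * s * p + M 1 3 * s * r)),
      D⁻¹ * (s * (M 0 0 * q * q + M 0 1 * q * s + M 0 2 * s * q + M 0 3 * s * s)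
      - q * (M 1 0 * q * q + M 1 1 * q * s + M 1 2 * s * q + M 1 3 * s * s));
      D⁻¹ * (p * (M 1 0 * p * p + M 1 1 * p * r + M 1 2 * r * p + M 1 3 * r * r)
      - r * (M 0 0 * p * p + M 0 1 * p * r + M 0 2 * r * p + M 0 3 * r * r)),
      D⁻¹ * (p * (M 1 0 * p * q + M 1 1 * p * s + M 1 2 * r * q + M 1 3 * r * s)
      - r * (M 0 0 * p * q + M 0 1 * p * s + M 0 2 * r * q + M 0 3 * r * s)),
      D⁻¹ * (p * (M 1 0 * q * p + M 1 1 * q * r + M 1 2 * s * p + M 1 3 * s * r)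
      - r * (M 0 0 * q * p + M 0 1 * q * r + M 0 2 * s * p + M 0 3 * s * r)),
      D⁻¹ * (p * (M 1 0 * q * q + M 1 1 * q * s + M 1 2 * s * q + M 1 3 * s * s)
      - r * (M 0 0 * q * q + M 0 1 * q * s + M 0 2 * s * q + M 0 3 * s * s))],
    h, ?_, ?_, ?_, ?_, ?_, ?_, ?_, ?_⟩ <;> simp <;> field_simp <;> rw [hD] <;> ring

theorem op_mscAlgebra (M : Matrix (Fin 2) (Fin 4) F) :
    (mscAlgebra M).op = mscAlgebra !![M 0 0, M 0 2, M 0 1, M 0 3; M 1 0, M 1 2, M 1 1, M 1 3] := by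
  refine LinearMap.ext fun x => LinearMap.ext fun y => ?_
  ext i
  fin_cases i
  · simp [AlgStr.op, mscAlgebra_apply_zero]; ring
  · simp [AlgStr.op, mscAlgebra_apply_one]; ring

/-! ### The trace forms as invariants. -/

namespace IsMscIso

variable {M N : Matrix (Fin 2) (Fin 4) F} {p q r s : F}

theorem iso (h : IsMscIso M N p q r s) : (mscAlgebra M).Iso (mscAlgebra N) :=
  mscAlgebra_iso_iff.2 ⟨p, q, r, s, h⟩

/-! Isomorphisms preserve the traces of the left and right multiplications. -/

theorem trace_left_fst (h : IsMscIso M N p q r s) :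
    M 0 0 + M 1 1 = p * (N 0 0 + N 1 1) + r * (N 0 2 + N 1 3) := by
  obtain ⟨hd, h00, h10, h01, h11, h02, h12, h03, h13⟩ := h
  apply mul_left_cancel₀ hd
  -- This is the trace of adj(f) applied to f L_x = L'_{f x} f, whence the factor det f.
  linear_combination s * h00 - q * h10 - r * h01 + p * h11

theorem trace_left_snd (h : IsMscIso M N p q r s) :
    M 0 2 + M 1 3 = q * (N 0 0 + N 1 1) + s * (N 0 2 + N 1 3) := by
  obtain ⟨hd, h00, h10, h01, h11, h02, h12, h03, h13⟩ := h
  apply mul_left_cancel₀ hd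
  linear_combination s * h02 - q * h12 - r * h03 + p * h13

theorem trace_right_fst (h : IsMscIso M N p q r s) :
    M 0 0 + M 1 2 = p * (N 0 0 + N 1 2) + r * (N 0 1 + N 1 3) := by
  obtain ⟨hd, h00, h10, h01, h11, h02, h12, h03, h13⟩ := h
  apply mul_left_cancel₀ hd
  linear_combination s * h00 - q * h10 - r * h02 + p * h12

theorem trace_right_snd (h : IsMscIso M N p q r s) :
    M 0 1 + M 1 3 = q * (N 0 0 + N 1 2) + s * (N 0 1 + N 1 3) := by
  obtain ⟨hd, h00, h10, h01, h11, h02, h12, h03, h13⟩ := h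
  apply mul_left_cancel₀ hd
  linear_combination s * h01 - q * h11 - r * h03 + p * h13

end IsMscIso

end

/-! ### The entries of the list: pairwise non-isomorphic, nontrivial, self-opposite. -/

set_option maxHeartbeats 4000000 in
theorem SelfOpLabel.eq_of_iso {F : Type*} [Field F] [CharP F 2] (l l' : SelfOpLabel F)
    (h : (mscAlgebra l.msc).Iso (mscAlgebra l'.msc)) : l = l' := by
  obtain ⟨p, q, r, s, h⟩ := mscAlgebra_iso_iff.1 h
  have h2 : (2 : F) = 0 := CharTwo.two_eq_zero
  -- The trace relations are linear in `p, q, r, s`: they give the identity between two `a1`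
  -- entries, and `p = 1`, `q = 0` among `a2`–`a5`.
  have t1 := h.trace_left_fst
  have t2 := h.trace_left_snd
  have t3 := h.trace_right_fst
  have t4 := h.trace_right_snd
  obtain ⟨hd, h00, h10, h01, h11, h02, h12, h03, h13⟩ := h
  cases l <;> cases l' <;>
    simp [SelfOpLabel.msc, CharTwo.A1, CharTwo.A2, CharTwo.A3, CharTwo.A4, CharTwo.A5,
      CharTwo.A10, CharTwo.A11, CharTwo.A12] at * <;> grind

theorem SelfOpLabel.ne_zero_and_op_iso {F : Type*} [Field F] [CharP F 2] (l : SelfOpLabel F) :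
    mscAlgebra l.msc ≠ 0 ∧ (mscAlgebra l.msc).op.Iso (mscAlgebra l.msc) := by
  have h2 : (2 : F) = 0 := CharTwo.two_eq_zero
  constructor
  · intro h
    have h' : ∀ x y i, mscAlgebra l.msc x y i = 0 := fun x y i => by simp [h]
    have e1 := fun i => (mscAlgebra_basis l.msc i).1.symm.trans (h' _ _ _)
    have e2 := fun i => (mscAlgebra_basis l.msc i).2.1.symm.trans (h' _ _ _)
    have e3 := fun i => (mscAlgebra_basis l.msc i).2.2.1.symm.trans (h' _ _ _)
    have e4 := fun i => (mscAlgebra_basis l.msc i).2.2.2.symm.trans (h' _ _ _)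
    rw [Fin.forall_fin_two] at e1 e2 e3 e4
    cases l <;>
      simp [SelfOpLabel.msc, CharTwo.A1, CharTwo.A2, CharTwo.A3, CharTwo.A4, CharTwo.A5,
        CharTwo.A10, CharTwo.A11, CharTwo.A12] at e1 e2 e3 e4 <;> grind
  · rw [op_mscAlgebra, mscAlgebra_iso_iff]
    cases l with
    | a1 =>
      -- Exchanging the basis vectors works for `a1`; all other entries are commutative, so the
      -- identity does.
      refine ⟨0, 1, 1, 0, ?_, ?_, ?_, ?_, ?_, ?_, ?_, ?_, ?_⟩ <;> simp [SelfOpLabel.msc, CharTwo.A1]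
    | _ =>
      refine ⟨1, 0, 0, 1, ?_, ?_, ?_, ?_, ?_, ?_, ?_, ?_, ?_⟩ <;>
        simp [SelfOpLabel.msc, CharTwo.A2, CharTwo.A3, CharTwo.A4, CharTwo.A5, CharTwo.A10,
          CharTwo.A11, CharTwo.A12]

/-! ### Reduction to normal forms. -/

section

variable {F : Type*} [Field F]

theorem exists_sq_eq_of_root
    (hF : ∀ p : Polynomial F, p.natDegree = 2 ∨ p.natDegree = 3 → ∃ x : F, p.IsRoot x)
    {a : F} (ha : a ≠ 0) (b c : F) : ∃ x, a * x ^ 2 + b * x + c = 0 := by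
  obtain ⟨x, hx⟩ := hF _ (.inl (Polynomial.natDegree_quadratic (b := b) (c := c) ha))
  exact ⟨x, by simpa using hx⟩

theorem exists_cubic_root
    (hF : ∀ p : Polynomial F, p.natDegree = 2 ∨ p.natDegree = 3 → ∃ x : F, p.IsRoot x)
    {a : F} (ha : a ≠ 0) (b c d : F) : ∃ x, a * x ^ 3 + b * x ^ 2 + c * x + d = 0 := by
  obtain ⟨x, hx⟩ := hF _ (.inr (Polynomial.natDegree_cubic (b := b) (c := c) (d := d) ha))
  exact ⟨x, by simpa using hx⟩

variable [CharP F 2]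

/-- The case in which the traces of the left and the right multiplications are independent. -/
theorem exists_iso_of_trace_independent (M : Matrix (Fin 2) (Fin 4) F)
    (hop : (mscAlgebra M).op.Iso (mscAlgebra M))
    (hD : (M 0 0 + M 1 2) * (M 0 2 + M 1 3) - (M 0 1 + M 1 3) * (M 0 0 + M 1 1) ≠ 0) :
    ∃ l : SelfOpLabel F, (mscAlgebra M).Iso (mscAlgebra l.msc) := by
  have h2 : (2 : F) = 0 := CharTwo.two_eq_zero
  generalize hDdef : (M 0 0 + M 1 2) * (M 0 2 + M 1 3) - (M 0 1 + M 1 3) * (M 0 0 + M 1 1) = D at hD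
  -- The inverse of the matrix with rows ρ, λ (signs are irrelevant here): in the new basis ρ and λ
  -- are the two coordinates.
  obtain ⟨N, hN⟩ := exists_isMscIso M (p := (M 0 2 + M 1 3) / D) (q := (M 0 1 + M 1 3) / D)
    (r := (M 0 0 + M 1 1) / D) (s := (M 0 0 + M 1 2) / D) (by
      have : (M 0 2 + M 1 3) / D * ((M 0 0 + M 1 2) / D) -
          (M 0 1 + M 1 3) / D * ((M 0 0 + M 1 1) / D) = 1 / D := by
        field_simp; rw [← hDdef]; ring
      rw [this]; exact one_div_ne_zero hD)
  have t1 : N 0 0 + N 1 1 = 0 := by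
    rw [hN.trace_left_fst]; field_simp; linear_combination (M 0 0 + M 1 1) * (M 0 2 + M 1 3) * h2
  have t2 : N 0 2 + N 1 3 = 1 := by
    rw [hN.trace_left_snd]; field_simp
    linear_combination (M 0 1 + M 1 3) * (M 0 0 + M 1 1) * h2 + hDdef
  have t3 : N 0 0 + N 1 2 = 1 := by
    rw [hN.trace_right_fst]; field_simp
    linear_combination (M 0 1 + M 1 3) * (M 0 0 + M 1 1) * h2 + hDdef
  have t4 : N 0 1 + N 1 3 = 0 := by
    rw [hN.trace_right_snd]; field_simp; linear_combination (M 0 1 + M 1 3) * (M 0 0 + M 1 2) * h2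
  have hopN := (hN.iso.op.trans hop).trans hN.iso.symm
  rw [op_mscAlgebra, mscAlgebra_iso_iff] at hopN
  obtain ⟨p, q, r, s, h⟩ := hopN
  have k1 := h.trace_left_fst
  have k2 := h.trace_left_snd
  have k3 := h.trace_right_fst
  have k4 := h.trace_right_snd
  simp only [Matrix.of_apply, Matrix.cons_val, t1, t2, t3, t4] at k1 k2 k3 k4
  obtain ⟨hd, h00, h10, h01, h11, h02, h12, h03, h13⟩ := h
  simp only [Matrix.of_apply, Matrix.cons_val] at h00 h10 h01 h11 h02 h12 h03 h13
  -- The isomorphism exchanges ρ and λ, so it must be the swap of the dual basis.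
  have er : r = 1 := by linear_combination -k1
  have es : s = 0 := by linear_combination -k2
  have ep : p = 0 := by linear_combination -k3
  have eq : q = 1 := by linear_combination -k4
  subst er es ep eq
  have e13 : N 1 3 = N 0 0 := by linear_combination -h10
  have e03 : N 0 3 = N 1 0 := by linear_combination -h00
  have e11 : N 1 1 = N 0 0 := by linear_combination t1 - N 0 0 * h2
  have e12 : N 1 2 = 1 + N 0 0 := by linear_combination t3 - N 0 0 * h2
  have e01 : N 0 1 = N 0 0 := by linear_combination t4 - e13 - N 0 0 * h2
  have e02 : N 0 2 = 1 + N 0 0 := by linear_combination t2 - e13 - N 0 0 * h2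
  have e : N = (SelfOpLabel.a1 (N 0 0) (N 1 0)).msc := by
    ext i j
    fin_cases i <;> fin_cases j <;>
      simp [SelfOpLabel.msc, CharTwo.A1, e13, e03, e11, e12, e01, e02]
  exact ⟨_, e ▸ hN.iso.symm⟩

/-- Commutative algebras with nonzero trace form. -/
theorem exists_iso_of_trace_ne_zero
    (hF : ∀ p : Polynomial F, p.natDegree = 2 ∨ p.natDegree = 3 → ∃ x : F, p.IsRoot x)
    (M : Matrix (Fin 2) (Fin 4) F) (h0 : M 0 1 = M 0 2) (h1 : M 1 1 = M 1 2)
    (ht : M 0 0 + M 1 1 ≠ 0 ∨ M 0 2 + M 1 3 ≠ 0) :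
    ∃ l : SelfOpLabel F, (mscAlgebra M).Iso (mscAlgebra l.msc) := by
  have h2 : (2 : F) = 0 := CharTwo.two_eq_zero
  -- New basis with λ(e₁) = 1 and e₂ spanning ker λ.
  have hN : ∃ N p q r s, IsMscIso N M p q r s ∧
      p * (M 0 0 + M 1 1) + r * (M 0 2 + M 1 3) = 1 ∧
      q * (M 0 0 + M 1 1) + s * (M 0 2 + M 1 3) = 0 := by
    by_cases h : M 0 0 + M 1 1 = 0
    · have h' := ht.resolve_left (not_not.2 h)
      obtain ⟨N, hN⟩ := exists_isMscIso M (p := 0) (q := 1) (r := (M 0 2 + M 1 3)⁻¹) (s := 0)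
        (by simpa using h')
      exact ⟨N, _, _, _, _, hN, by field_simp; simp, by simp [h]⟩
    · obtain ⟨N, hN⟩ := exists_isMscIso M (p := (M 0 0 + M 1 1)⁻¹) (q := M 0 2 + M 1 3) (r := 0)
        (s := M 0 0 + M 1 1) (by simp [h])
      exact ⟨N, _, _, _, _, hN, by field_simp; simp,
        by linear_combination (M 0 2 + M 1 3) * (M 0 0 + M 1 1) * h2⟩
  obtain ⟨N, p, q, r, s, hN, u1, u2⟩ := hN
  have t1 := hN.trace_left_fst
  have t2 := hN.trace_left_snd
  have t3 := hN.trace_right_fst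
  have t4 := hN.trace_right_snd
  rw [u1] at t1
  rw [u2] at t2
  rw [h0, ← h1, u1] at t3
  rw [h0, ← h1, u2] at t4
  have e11 : N 1 1 = 1 + N 0 0 := by linear_combination t1 - N 0 0 * h2
  have e12 : N 1 2 = 1 + N 0 0 := by linear_combination t3 - N 0 0 * h2
  have e13 : N 1 3 = N 0 1 := by linear_combination t4 - N 0 1 * h2
  have e02 : N 0 2 = N 0 1 := by linear_combination t2 - t4
  suffices ∃ l : SelfOpLabel F, ∃ p q r s, IsMscIso l.msc N p q r s by
    obtain ⟨l, p, q, r, s, h⟩ := this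
    exact ⟨l, hN.iso.symm.trans h.iso.symm⟩
  clear hN t1 t2 t3 t4 u1 u2
  by_cases a4 : N 0 3 = 0
  · by_cases a2 : N 0 1 = 0
    · by_cases a1 : N 0 0 = 0
      · by_cases b1 : N 1 0 = 0
        · refine ⟨.a4 0, 1, 0, 0, 1, ?_⟩
          constructor <;> simp [SelfOpLabel.msc, CharTwo.A4] <;> grind
        · refine ⟨.a5, 1, 0, 0, N 1 0, ?_⟩
          constructor <;> simp [SelfOpLabel.msc, CharTwo.A5] <;> grind
      · refine ⟨.a4 (N 0 0), 1, 0, N 1 0 / N 0 0, 1, ?_⟩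
        constructor <;> simp [SelfOpLabel.msc, CharTwo.A4] <;> grind
    -- The equation says that e₁ + (x / `N 0 1`) e₂ has its square on its own line.
    · obtain ⟨x, hx⟩ := exists_sq_eq_of_root hF (one_ne_zero) (N 0 0) (N 1 0 * N 0 1)
      refine ⟨.a3 (N 0 0), 1, 0, x / N 0 1, 1 / N 0 1, ?_⟩
      constructor <;> simp [SelfOpLabel.msc, CharTwo.A3] <;> grind
  -- With e₂' = c e₂, the vector e₁' = e₁ + (`N 0 1` / `N 0 3`) e₂ is exactly the square of e₂'; the
  -- traces then fix all but two constants.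
  · obtain ⟨c, hc⟩ := exists_sq_eq_of_root hF a4 0 1
    have hc0 : c ≠ 0 := by rintro rfl; simp at hc
    have hc' : N 0 3 * c ^ 2 = 1 := by linear_combination hc - h2
    have hN03 : N 0 3 = 1 / c ^ 2 := by field_simp; exact hc'
    obtain ⟨L, hL⟩ := exists_isMscIso N (p := 1) (q := 0) (r := N 0 1 / N 0 3) (s := c)
      (by simpa using hc0)
    refine ⟨.a2 (L 0 0) (L 1 0), 1, 0, N 0 1 / N 0 3, c, ?_⟩
    have : (SelfOpLabel.a2 (L 0 0) (L 1 0)).msc = L := by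
      have s1 := hL.trace_left_fst
      have s3 := hL.trace_right_fst
      obtain ⟨hd, h00, h10, h01, h11, h02, h12, h03, h13⟩ := hL
      ext i j
      fin_cases i <;> fin_cases j <;> simp [SelfOpLabel.msc, CharTwo.A2] <;> grind
    rw [this]; exact hL

/-- Commutative algebras with vanishing trace form. -/
theorem exists_iso_of_trace_eq_zero
    (hF : ∀ p : Polynomial F, p.natDegree = 2 ∨ p.natDegree = 3 → ∃ x : F, p.IsRoot x)
    (M : Matrix (Fin 2) (Fin 4) F) (h0 : M 0 1 = M 0 2) (h1 : M 1 1 = M 1 2)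
    (t1 : M 0 0 + M 1 1 = 0) (t2 : M 0 2 + M 1 3 = 0) (hM : mscAlgebra M ≠ 0) :
    ∃ l : SelfOpLabel F, (mscAlgebra M).Iso (mscAlgebra l.msc) := by
  have h2 : (2 : F) = 0 := CharTwo.two_eq_zero
  have hN : ∃ N p q r s, IsMscIso N M p q r s ∧ N 1 0 = 0 := by
    by_cases h : M 1 0 = 0
    · refine ⟨M, 1, 0, 0, 1, ?_, h⟩
      constructor <;> simp
    -- The cubic expresses that (x, 1) is proportional to its square; its linear coefficient `M 1 3`
    -- equals `M 0 1` because the trace vanishes.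
    · obtain ⟨x, hx⟩ := exists_cubic_root hF h (M 0 0) (M 0 1) (M 0 3)
      obtain ⟨N, hN⟩ := exists_isMscIso M (p := x) (q := 1) (r := 1) (s := 0) (by simp)
      exact ⟨N, _, _, _, _, hN, by grind [hN.h00, hN.h10]⟩
  obtain ⟨N, p, q, r, s, hN, e10⟩ := hN
  have s1 := hN.trace_left_fst
  have s2 := hN.trace_left_snd
  have s3 := hN.trace_right_fst
  have s4 := hN.trace_right_snd
  simp only [h0, ← h1, t1, t2, mul_zero, add_zero] at s1 s2 s3 s4
  have e11 : N 1 1 = N 0 0 := by linear_combination s1 - N 0 0 * h2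
  have e12 : N 1 2 = N 0 0 := by linear_combination s3 - N 0 0 * h2
  have e13 : N 1 3 = N 0 1 := by linear_combination s4 - N 0 1 * h2
  have e02 : N 0 2 = N 0 1 := by linear_combination s2 - s4
  suffices ∃ l : SelfOpLabel F, ∃ p q r s, IsMscIso l.msc N p q r s by
    obtain ⟨l, p, q, r, s, h⟩ := this
    exact ⟨l, hN.iso.symm.trans h.iso.symm⟩
  clear s1 s2 s3 s4
  by_cases a : N 0 0 = 0
  · by_cases b : N 0 1 = 0
    · by_cases d : N 0 3 = 0
      · refine absurd ?_ hM
        obtain ⟨f, hf⟩ := hN.iso.symm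
        refine LinearMap.ext fun x => LinearMap.ext fun y => f.injective ?_
        rw [hf]
        ext i
        fin_cases i
        · simp [mscAlgebra_apply_zero, a, b, d, e02]
        · simp [mscAlgebra_apply_one, a, b, e10, e11, e12, e13]
      · refine ⟨.a12, 0, N 0 3, 1, 0, ?_⟩
        constructor <;> simp [SelfOpLabel.msc, CharTwo.A12] <;> grind
    -- Here e₁² = 0, and the second new vector is an idempotent.
    · refine ⟨.a10, 1, N 0 3 / N 0 1 ^ 2, 0, 1 / N 0 1, ?_⟩
      constructor <;> simp [SelfOpLabel.msc, CharTwo.A10] <;> grind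
  · obtain ⟨x, hx⟩ := exists_sq_eq_of_root hF a (N 0 1) (N 0 3)
    by_cases b : N 0 1 = 0
    -- The choice of `x` makes x e₁ + e₂ square to zero; e₁ / `N 0 0` is idempotent.
    · refine ⟨.a10, x, 1 / N 0 0, 1, 0, ?_⟩
      constructor <;> simp [SelfOpLabel.msc, CharTwo.A10] <;> grind
    -- Both new basis vectors are idempotent, the second by the equation for `x`.
    · refine ⟨.a11, 1 / N 0 0, x / N 0 1, 0, 1 / N 0 1, ?_⟩
      have hd : N 0 3 = N 0 0 * x ^ 2 + N 0 1 * x := by linear_combination N 0 3 * h2 - hx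
      have h11 : (1 : F) + 1 = 0 := by rw [one_add_one_eq_two, h2]
      constructor <;>
        simp [SelfOpLabel.msc, CharTwo.A11, a, b, e10, e11, e12, e13, e02, hd] <;> field_simp
      · ring
      · ring
      · linear_combination -(x ^ 2 * N 0 0 + x * N 0 1) * h2
      · simp [h11]

theorem exists_iso_of_op_iso
    (hF : ∀ p : Polynomial F, p.natDegree = 2 ∨ p.natDegree = 3 → ∃ x : F, p.IsRoot x)
    (M : Matrix (Fin 2) (Fin 4) F) (hM : mscAlgebra M ≠ 0)
    (hop : (mscAlgebra M).op.Iso (mscAlgebra M)) :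
    ∃ l : SelfOpLabel F, (mscAlgebra M).Iso (mscAlgebra l.msc) := by
  have h2 : (2 : F) = 0 := CharTwo.two_eq_zero
  by_cases hD : (M 0 0 + M 1 2) * (M 0 2 + M 1 3) - (M 0 1 + M 1 3) * (M 0 0 + M 1 1) = 0
  swap
  · exact exists_iso_of_trace_independent M hop hD
  have key : M 0 1 = M 0 2 ∧ M 1 1 = M 1 2 := by
    rw [op_mscAlgebra, mscAlgebra_iso_iff] at hop
    obtain ⟨p, q, r, s, h⟩ := hop
    have k1 := h.trace_left_fst
    have k2 := h.trace_left_snd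
    have k3 := h.trace_right_fst
    have k4 := h.trace_right_snd
    simp only [Matrix.of_apply, Matrix.cons_val] at k1 k2 k3 k4
    generalize hx : M 0 0 + M 1 1 = x at *
    generalize hy : M 0 2 + M 1 3 = y at *
    generalize hz : M 0 0 + M 1 2 = z at *
    generalize hw : M 0 1 + M 1 3 = w at *
    have hxz : x = z ∧ y = w := by
      -- Dependence reads ρ = cλ or λ = 0; applying the swap twice gives c² = 1, that is (c + 1)² =
      -- 0.
      have : ∃ c, (z = c * x ∧ w = c * y) ∨ (x = 0 ∧ y = 0) := by
        by_cases hx0 : x = 0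
        · by_cases hy0 : y = 0
          · exact ⟨0, .inr ⟨hx0, hy0⟩⟩
          · exact ⟨w / y, .inl ⟨by grind, by grind⟩⟩
        · exact ⟨z / x, .inl ⟨by grind, by grind⟩⟩
      obtain ⟨c, ⟨rfl, rfl⟩ | ⟨rfl, rfl⟩⟩ := this
      · have c1 : (c + 1) ^ 2 * x = 0 := by grind
        have c2 : (c + 1) ^ 2 * y = 0 := by grind
        grind
      · grind
    -- λ and ρ share the diagonal terms `M 0 0` and `M 1 3`; cancelling them leaves e₁e₂ = e₂e₁.
    constructor
    · linear_combination hw - hy - hxz.2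
    · linear_combination hx - hz + hxz.1
  by_cases t : M 0 0 + M 1 1 = 0 ∧ M 0 2 + M 1 3 = 0
  · exact exists_iso_of_trace_eq_zero hF M key.1 key.2 t.1 t.2 hM
  · exact exists_iso_of_trace_ne_zero hF M key.1 key.2 (not_and_or.1 t)

end

theorem mainTheorem9 {F : Type*} [Field F] [CharP F 2]
    (hF : ∀ p : Polynomial F, p.natDegree = 2 ∨ p.natDegree = 3 → ∃ x : F, p.IsRoot x) :
    -- every algebra of the list is nontrivial and isomorphic to its opposite
    (∀ l : SelfOpLabel F,
      mscAlgebra l.msc ≠ 0 ∧ (mscAlgebra l.msc).op.Iso (mscAlgebra l.msc)) ∧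
    -- every nontrivial two-dimensional algebra isomorphic to its opposite is in the list
    (∀ (V : Type*) [AddCommGroup V] [Module F V] (m : AlgStr F V),
      Module.finrank F V = 2 → m ≠ 0 → m.op.Iso m →
        ∃ l : SelfOpLabel F, m.Iso (mscAlgebra l.msc)) ∧
    -- different entries of the list are not isomorphic
    (∀ l l' : SelfOpLabel F, (mscAlgebra l.msc).Iso (mscAlgebra l'.msc) → l = l') := by
  refine ⟨SelfOpLabel.ne_zero_and_op_iso, fun V _ _ m hV hm hop => ?_, SelfOpLabel.eq_of_iso⟩
  obtain ⟨M, hM⟩ := exists_iso_mscAlgebra m hV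
  have hM0 : mscAlgebra M ≠ 0 := by
    rintro h
    obtain ⟨f, hf⟩ := hM
    refine hm (LinearMap.ext fun x => LinearMap.ext fun y => f.injective ?_)
    rw [hf, h]
    simp
  obtain ⟨l, hl⟩ := exists_iso_of_op_iso hF M hM0 ((hM.symm.op.trans hop).trans hM)
  exact ⟨l, hM.trans hl⟩
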